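/- Let $r\ge 1$ be an integer, let $q=2^r$, and let $\mathbb{F}_q$ be the finite field with $q$ elements. For a monic polynomial $f\in\mathbb{F}_q[T]$ put $\Lambda_q(f)=\deg P$ if $f=P^k$ for some monic irreducible $P\in\mathbb{F}_q[T]$ and some integer $k\ge 1$, and $\Lambda_q(f)=0$ otherwise. For $n\in\mathbb{N}$ and $t_1,t_2,t_3\in\mathbb{F}_q$ let \[ \psi_q(n,t_1,t_2,t_3)=\sum_{f}\Lambda_q(f), \] where $f$ runs over the monic polynomials of degree $n$ in $\mathbb{F}_q[T]$ whose first three next-to-leading coefficients (the coefficients of $T^{n-1},T^{n-2},T^{n-3}$, a coefficient of negative index being read as $0$) are $t_1,t_2,t_3$ respectively. Then for all $t_1,t_2,t_3\in\mathbb{F}_q$, \[ \psi_q(24,t_1,t_2,t_3)=q^{21}-q^{10}\left(2q^2\cdot 1_{t_1=t_2=t_3=0}-q\cdot 1_{t_1=t_2=0}-1_{t_1=0}\right), \] where $1_E$ equals $1$ if the condition $E$ holds and $0$ otherwise. -/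

import Mathlib

open Polynomial

/-- The `j`-th next-to-leading coefficient of `f`, that is the coefficient of
`T ^ (deg f - j)`; it is `0` by convention when `j > deg f`. -/
noncomputable def nextToLeadingCoeff {F : Type*} [Field F] (f : F[X]) (j : ℕ) : F :=
  if j ≤ f.natDegree then f.coeff (f.natDegree - j) else 0

open Classical in
/-- The von Mangoldt function on monic polynomials: `deg P` if `f = P ^ k` with `P` monic
irreducible and `k ≥ 1`, and `0` otherwise. -/
noncomputable def polyVonMangoldt {F : Type*} [Field F] (f : F[X]) : ℂ :=
  if h : ∃ P : F[X], P.Monic ∧ Irreducible P ∧ ∃ k : ℕ, 1 ≤ k ∧ f = P ^ k then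
    (h.choose.natDegree : ℂ)
  else 0

/-- The monic polynomials of degree `n` whose first `ℓ` next-to-leading coefficients are
`t 0, …, t (ℓ - 1)`. -/
def monicPrescribed {F : Type*} [Field F] (n : ℕ) {ℓ : ℕ} (t : Fin ℓ → F) : Set F[X] :=
  {f | f.Monic ∧ f.natDegree = n ∧ ∀ i : Fin ℓ, nextToLeadingCoeff f (i + 1) = t i}

/-- The sum of the von Mangoldt function over `monicPrescribed n t` (a finite set when `F` is
finite, see `monicPrescribed_finite`). -/
noncomputable def polyPsi {F : Type*} [Field F] (n : ℕ) {ℓ : ℕ} (t : Fin ℓ → F) : ℂ :=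
  ∑ᶠ f ∈ monicPrescribed n t, polyVonMangoldt f

/-- The value of `polyVonMangoldt` does not depend on the chosen representation. -/
theorem polyVonMangoldt_pow {F : Type*} [Field F] {P : F[X]} (hP : P.Monic)
    (hirr : Irreducible P) {k : ℕ} (hk : 1 ≤ k) :
    polyVonMangoldt (P ^ k) = (P.natDegree : ℂ) := by
  have h : ∃ Q : F[X], Q.Monic ∧ Irreducible Q ∧ ∃ m : ℕ, 1 ≤ m ∧ P ^ k = Q ^ m :=
    ⟨P, hP, hirr, k, hk, rfl⟩
  unfold polyVonMangoldt
  rw [dif_pos h]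
  obtain ⟨hQ, hQirr, m, hm, e⟩ := h.choose_spec
  have hdvd : P ∣ h.choose := by
    have h1 : P ∣ h.choose ^ m := e ▸ dvd_pow_self P (by omega)
    exact hirr.prime.dvd_of_dvd_pow h1
  have hass : Associated P h.choose := hirr.associated_of_dvd hQirr hdvd
  rw [← eq_of_monic_of_associated hP hQ hass]

theorem monicPrescribed_finite {F : Type*} [Field F] [Finite F] (n : ℕ) {ℓ : ℕ}
    (t : Fin ℓ → F) : (monicPrescribed n t).Finite := by
  have h : Function.Injective
      (fun f : {f : F[X] // f.natDegree ≤ n} => fun i : Fin (n + 1) => f.1.coeff i) := by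
    rintro ⟨f, hf⟩ ⟨g, hg⟩ e
    refine Subtype.ext (Polynomial.ext fun i => ?_)
    by_cases hi : i < n + 1
    · exact congrFun e ⟨i, hi⟩
    · rw [coeff_eq_zero_of_natDegree_lt (show f.natDegree < i by omega),
        coeff_eq_zero_of_natDegree_lt (show g.natDegree < i by omega)]
  have hfin : Finite {f : F[X] // f.natDegree ≤ n} := Finite.of_injective _ h
  exact (Set.finite_coe_iff.mp hfin : {f : F[X] | f.natDegree ≤ n}.Finite).subset fun f hf => hf.2.1.le

/-! In characteristic two, `coeffTriple` turns products of monic polynomials into sums in a finite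
abelian group of exponent dividing 4, so by Fourier inversion (`eq_of_sum_addChar_eq`) it suffices
to find the sum of `Λ χ` in degree 24 for each character `χ` of that group.

For `χ ≠ 0` the character sums over degree at least 3 vanish, so the L-function is `1 + A u + B u ^
2 = (1 - α₁ u)(1 - α₂ u)`, and its logarithmic derivative gives `twistedPsi χ n = -(α₁ ^ n + α₂ ^
n)` (`twistedPsi_recurrence`). Up to a factor depending only on the first coordinate, `χ` is `ψ (β b
+ γ c)`.

If `γ ≠ 0`, then `B = q ε` with `ε ^ 4 = 1`, and `A ^ 2 = m B` with an integer `0 ≤ m ≤ 4`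
(`level_three_relation`). Hence `α₁ / α₂ + α₂ / α₁ = m - 2`, the ratio is a root of unity of order
1, 2, 3, 4 or 6, and `α₁ ^ 24 = α₂ ^ 24 = B ^ 12 = q ^ 12`: the value is `-2 q ^ 12`. If `γ = 0 ≠
β`, then `B = 0` and `A ^ 2` is `q` times a fourth root of unity: the value is `-q ^ 12`. If `β = γ
= 0`, then `A = B = 0`. The trivial character gives `q ^ 24`. -/

section MonicPolynomials

/-! ### Monic polynomials and the von Mangoldt convolution. -/

variable {F : Type*} [Field F]

theorem nextToLeadingCoeff_eq_coeff_reverse (f : F[X]) (j : ℕ) :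
    nextToLeadingCoeff f j = f.reverse.coeff j := by
  rw [nextToLeadingCoeff, coeff_reverse]
  split_ifs with h
  · rw [revAt_le h]
  · rw [revAt_eq_self_of_lt (by omega), coeff_eq_zero_of_natDegree_lt (by omega)]

theorem nextToLeadingCoeff_X_mul_add_C {f : F[X]} (hf : f ≠ 0) (a : F) (j : ℕ) :
    nextToLeadingCoeff (X * f + C a) j =
      if j ≤ f.natDegree then nextToLeadingCoeff f j
      else if j = f.natDegree + 1 then a else 0 := by
  have hd : (X * f + C a).natDegree = f.natDegree + 1 := by
    rw [natDegree_add_C, natDegree_X_mul hf]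
  unfold nextToLeadingCoeff
  rw [hd]
  by_cases h1 : j ≤ f.natDegree
  · rw [if_pos (by omega), if_pos h1, if_pos h1,
      show f.natDegree + 1 - j = (f.natDegree - j) + 1 by omega]
    simp
  · by_cases h2 : j = f.natDegree + 1
    · subst h2; simp
    · rw [if_neg (by omega), if_neg h1, if_neg h2]

theorem Polynomial.Monic.X_mul_add_C {f : F[X]} (hm : f.Monic) (a : F) :
    (X * f + C a).Monic ∧ (X * f + C a).natDegree = f.natDegree + 1 := by
  have h1 : (X * f).natDegree = f.natDegree + 1 := natDegree_X_mul hm.ne_zero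
  refine ⟨?_, by rw [natDegree_add_C, h1]⟩
  rw [Monic, leadingCoeff_add_of_degree_lt']
  · exact monic_X.mul hm
  · exact degree_lt_degree (by rw [natDegree_C, h1]; omega)

theorem polyVonMangoldt_ne_zero {f : F[X]} (h : polyVonMangoldt f ≠ 0) :
    ∃ P : F[X], P.Monic ∧ Irreducible P ∧ ∃ k : ℕ, 1 ≤ k ∧ f = P ^ k := by
  by_contra hc
  exact h (by rw [polyVonMangoldt, dif_neg hc])

variable [Finite F]

/-- The finite set of monic polynomials of degree `n`. -/
noncomputable def monicsOfDegree (F : Type*) [Field F] [Finite F] (n : ℕ) : Finset F[X] :=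
  (monicPrescribed_finite n (Fin.elim0 : Fin 0 → F)).toFinset

theorem mem_monicsOfDegree {n : ℕ} {f : F[X]} :
    f ∈ monicsOfDegree F n ↔ f.Monic ∧ f.natDegree = n := by
  simp [monicsOfDegree, monicPrescribed]

theorem monicsOfDegree_zero : monicsOfDegree F 0 = {1} := by
  ext f
  rw [mem_monicsOfDegree, Finset.mem_singleton]
  refine ⟨fun h => h.1.natDegree_eq_zero.1 h.2, ?_⟩
  rintro rfl
  exact ⟨monic_one, natDegree_one⟩

theorem sum_monicsOfDegree_succ [Fintype F] {M : Type*} [AddCommMonoid M] (n : ℕ)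
    (φ : F[X] → M) :
    ∑ f ∈ monicsOfDegree F (n + 1), φ f
      = ∑ f ∈ monicsOfDegree F n, ∑ a : F, φ (X * f + C a) := by
  rw [← Finset.sum_product']
  symm
  refine Finset.sum_bij' (fun p _ => X * p.1 + C p.2) (fun f _ => (f.divX, f.coeff 0))
    ?_ ?_ ?_ ?_ ?_
  · rintro ⟨f, a⟩ h
    simp only [Finset.mem_product, mem_monicsOfDegree, Finset.mem_univ, and_true] at h ⊢
    obtain ⟨hm, rfl⟩ := h
    exact hm.X_mul_add_C a
  · intro f h
    simp only [Finset.mem_product, mem_monicsOfDegree, Finset.mem_univ, and_true] at h ⊢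
    have hd : f.divX.natDegree = n := by rw [natDegree_divX_eq_natDegree_tsub_one, h.2]; rfl
    refine ⟨?_, hd⟩
    rw [Monic, leadingCoeff, hd, coeff_divX, ← h.2]
    exact h.1
  · rintro ⟨f, a⟩ _
    refine Prod.ext ?_ (by simp)
    ext i
    simp [coeff_divX]
  · intro f _
    exact X_mul_divX_add f
  · intros; rfl

open Classical UniqueFactorizationMonoid in
/-- The convolution identity `Λ * 1 = deg` on monic polynomials. -/
theorem sum_polyVonMangoldt_divisors {f : F[X]} (hf : f.Monic) :
    ∑ p ∈ (Finset.range (f.natDegree + 1)).sigma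
        (fun k => (monicsOfDegree F k).filter (· ∣ f)), polyVonMangoldt p.2
      = (f.natDegree : ℂ) := by
  have hf0 : f ≠ 0 := hf.ne_zero
  have hprod : (normalizedFactors f).prod = f := by
    rw [prod_normalizedFactors_eq hf0]
    exact hf.normalize_eq_self
  have hfac : ∀ P ∈ normalizedFactors f, Irreducible P ∧ P.Monic := fun P hP =>
    have hirr := irreducible_of_normalized_factor P hP
    ⟨hirr, by
      rw [← normalize_normalized_factor P hP]
      exact monic_normalize hirr.ne_zero⟩
  have hpow : ∀ (P : F[X]) (k : ℕ), Irreducible P → P.Monic →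
      (P ^ k ∣ f ↔ k ≤ (normalizedFactors f).count P) := by
    intro P k hirr hm
    rw [pow_dvd_iff_le_emultiplicity,
      le_emultiplicity_iff_replicate_le_normalizedFactors hirr hf0, hm.normalize_eq_self,
      Multiset.le_count_iff_replicate_le]
  have hsum : ∑ p ∈ (normalizedFactors f).toFinset.sigma
      (fun P => Finset.Icc 1 ((normalizedFactors f).count P)), (p.1.natDegree : ℂ)
        = f.natDegree := by
    rw [Finset.sum_sigma]
    conv_rhs => rw [← hprod, natDegree_multiset_prod _ (zero_notMem_normalizedFactors f),
      Finset.sum_multiset_map_count]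
    simp
  rw [← hsum]
  symm
  -- Only prime powers `P ^ k` with `k` at most the multiplicity of `P` in `f` contribute; the other
  -- divisors, `1` included, have `Λ = 0`.
  refine Finset.sum_of_injOn (fun p => ⟨p.2 * p.1.natDegree, p.1 ^ p.2⟩) ?_ ?_ ?_ ?_
  · rintro ⟨P, k⟩ h ⟨Q, m⟩ h' e
    simp only [Finset.coe_sigma, Set.mem_sigma_iff, Finset.mem_coe, Multiset.mem_toFinset,
      Finset.mem_Icc] at h h'
    obtain ⟨hPi, hPm⟩ := hfac P h.1
    obtain ⟨hQi, hQm⟩ := hfac Q h'.1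
    simp only [Sigma.mk.injEq, heq_eq_eq] at e
    have hPQ : P = Q := by
      have h1 : P ∣ Q ^ m := e.2 ▸ dvd_pow_self P (by omega)
      exact eq_of_monic_of_associated hPm hQm
        (hPi.associated_of_dvd hQi (hPi.prime.dvd_of_dvd_pow h1))
    subst hPQ
    have := Nat.eq_of_mul_eq_mul_right hPi.natDegree_pos e.1
    subst this
    rfl
  · rintro ⟨P, k⟩ h
    simp only [Finset.coe_sigma, Set.mem_sigma_iff, Finset.mem_coe, Multiset.mem_toFinset,
      Finset.mem_Icc, Finset.mem_filter, Finset.mem_range, mem_monicsOfDegree] at h ⊢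
    obtain ⟨hPi, hPm⟩ := hfac P h.1
    have hdvd := (hpow P k hPi hPm).2 h.2.2
    have hdeg : (P ^ k).natDegree = k * P.natDegree := natDegree_pow P k
    exact ⟨by have := natDegree_le_of_dvd hdvd hf0; omega, ⟨hPm.pow k, hdeg⟩, hdvd⟩
  · rintro ⟨n, d⟩ h hni
    simp only [Finset.mem_sigma, Finset.mem_filter, Finset.mem_range, mem_monicsOfDegree] at h
    by_contra hne
    obtain ⟨P, hm, hirr, k, hk, rfl⟩ := polyVonMangoldt_ne_zero hne
    have hle := (hpow P k hirr hm).1 h.2.2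
    refine hni ⟨⟨P, k⟩, ?_, ?_⟩
    · simp only [Finset.coe_sigma, Set.mem_sigma_iff, Finset.mem_coe, Multiset.mem_toFinset,
        Finset.mem_Icc]
      exact ⟨Multiset.count_pos.1 (by omega), hk, hle⟩
    · have := h.2.1.2
      rw [natDegree_pow] at this
      simp [this]
  · rintro ⟨P, k⟩ h
    simp only [Finset.mem_sigma, Multiset.mem_toFinset, Finset.mem_Icc] at h
    obtain ⟨hPi, hPm⟩ := hfac P h.1
    exact (polyVonMangoldt_pow hPm hPi h.2.1).symm

open Classical in
/-- The logarithmic derivative of the Euler product of a multiplicative function `φ`,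
compared coefficient by coefficient. -/
theorem natCast_mul_sum_monicsOfDegree (φ : F[X] → ℂ)
    (hφ : ∀ f g : F[X], f.Monic → g.Monic → φ (f * g) = φ f * φ g) (n : ℕ) :
    (n : ℂ) * ∑ f ∈ monicsOfDegree F n, φ f
      = ∑ k ∈ Finset.range (n + 1),
          (∑ d ∈ monicsOfDegree F k, polyVonMangoldt d * φ d) *
            ∑ e ∈ monicsOfDegree F (n - k), φ e := by
  have h1 : ∀ f ∈ monicsOfDegree F n, (n : ℂ) * φ f
      = ∑ k ∈ Finset.range (n + 1), ∑ d ∈ monicsOfDegree F k,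
          if d ∣ f then polyVonMangoldt d * φ f else 0 := by
    intro f hf
    rw [mem_monicsOfDegree] at hf
    have := sum_polyVonMangoldt_divisors hf.1
    rw [hf.2, Finset.sum_sigma] at this
    rw [← this, Finset.sum_mul]
    refine Finset.sum_congr rfl fun k _ => ?_
    rw [Finset.sum_mul, Finset.sum_filter]
  rw [Finset.mul_sum, Finset.sum_congr rfl h1, Finset.sum_comm]
  refine Finset.sum_congr rfl fun k hk => ?_
  rw [Finset.sum_comm, Finset.sum_mul]
  refine Finset.sum_congr rfl fun d hd => ?_
  rw [mem_monicsOfDegree] at hd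
  rw [← Finset.sum_filter, Finset.mul_sum]
  symm
  refine Finset.sum_bij (fun e _ => d * e) ?_ ?_ ?_ ?_
  · intro e he
    rw [mem_monicsOfDegree] at he
    rw [Finset.mem_filter, mem_monicsOfDegree]
    refine ⟨⟨hd.1.mul he.1, ?_⟩, dvd_mul_right d e⟩
    rw [hd.1.natDegree_mul he.1, hd.2, he.2]
    have := Finset.mem_range.1 hk
    omega
  · intro e _ e' _ h
    exact mul_left_cancel₀ hd.1.ne_zero h
  · intro f hf
    rw [Finset.mem_filter, mem_monicsOfDegree] at hf
    obtain ⟨⟨hm, hdeg⟩, e, rfl⟩ := hf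
    have hem : e.Monic := hd.1.of_mul_monic_left hm
    refine ⟨e, ?_, rfl⟩
    rw [mem_monicsOfDegree]
    rw [hd.1.natDegree_mul hem, hd.2] at hdeg
    exact ⟨hem, by omega⟩
  · intro e he
    rw [mem_monicsOfDegree] at he
    rw [hφ d e hd.1 he.1]
    ring

end MonicPolynomials

/-! ### The group of coefficient triples. -/

/-- Triples over a field, with the group law making `(t₁, t₂, s₃)` additive. -/
@[ext]
structure CoeffTriple (F : Type*) where
  fst : F
  snd : F
  trd : F

namespace CoeffTriple

section Card

variable {F : Type*}

/-- The underlying product type. -/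
def equivProd (F : Type*) : CoeffTriple F ≃ F × F × F where
  toFun x := (x.fst, x.snd, x.trd)
  invFun x := ⟨x.1, x.2.1, x.2.2⟩
  left_inv _ := rfl
  right_inv _ := rfl

noncomputable instance [Fintype F] : Fintype (CoeffTriple F) :=
  Fintype.ofEquiv _ (equivProd F).symm

theorem card_eq [Fintype F] : Fintype.card (CoeffTriple F) = Fintype.card F ^ 3 := by
  rw [Fintype.card_congr (equivProd F)]
  simp only [Fintype.card_prod]
  ring

theorem sum_eq [Fintype F] {M : Type*} [AddCommMonoid M] (φ : CoeffTriple F → M) :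
    ∑ x, φ x = ∑ a, ∑ b, ∑ c, φ ⟨a, b, c⟩ := by
  rw [← Equiv.sum_comp (equivProd F).symm, Fintype.sum_prod_type]
  refine Finset.sum_congr rfl fun a _ => ?_
  rw [Fintype.sum_prod_type]
  rfl

end Card

variable {F : Type*} [Field F]

/-- The first two coordinates multiply like `1 + x u + y u ^ 2` modulo `u ^ 3`; the third is a
direct additive factor. -/
instance : Add (CoeffTriple F) :=
  ⟨fun x y => ⟨x.fst + y.fst, x.snd + y.snd + x.fst * y.fst, x.trd + y.trd⟩⟩

instance : Zero (CoeffTriple F) := ⟨⟨0, 0, 0⟩⟩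

instance : Neg (CoeffTriple F) := ⟨fun x => ⟨-x.fst, x.fst ^ 2 - x.snd, -x.trd⟩⟩

theorem add_def (x y : CoeffTriple F) :
    x + y = ⟨x.fst + y.fst, x.snd + y.snd + x.fst * y.fst, x.trd + y.trd⟩ := rfl

theorem zero_def : (0 : CoeffTriple F) = ⟨0, 0, 0⟩ := rfl

theorem neg_def (x : CoeffTriple F) : -x = ⟨-x.fst, x.fst ^ 2 - x.snd, -x.trd⟩ := rfl

instance : AddCommGroup (CoeffTriple F) where
  add_assoc x y z := by simp only [add_def, mk.injEq]; refine ⟨?_, ?_, ?_⟩ <;> ring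
  zero_add x := by ext <;> simp [add_def, zero_def]
  add_zero x := by ext <;> simp [add_def, zero_def]
  add_comm x y := by simp only [add_def, mk.injEq]; refine ⟨?_, ?_, ?_⟩ <;> ring
  neg_add_cancel x := by
    simp only [add_def, neg_def, zero_def, mk.injEq]; refine ⟨?_, ?_, ?_⟩ <;> ring
  nsmul := nsmulRec
  zsmul := zsmulRec

theorem four_nsmul_eq_zero [CharP F 2] (x : CoeffTriple F) : 4 • x = 0 := by
  have h : (2 : F) = 0 := CharTwo.two_eq_zero
  rw [show 4 • x = (x + x) + (x + x) by abel]
  simp only [add_def, zero_def, mk.injEq]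
  refine ⟨?_, ?_, ?_⟩
  · linear_combination 2 * x.fst * h
  · linear_combination (2 * x.snd + 3 * x.fst ^ 2) * h
  · linear_combination 2 * x.trd * h

end CoeffTriple

/-- In characteristic two this is a homomorphism from the monic polynomials to `CoeffTriple F`;
the last component is the third power sum of the roots. -/
noncomputable def coeffTriple {F : Type*} [Field F] (f : F[X]) : CoeffTriple F :=
  ⟨nextToLeadingCoeff f 1, nextToLeadingCoeff f 2,
    nextToLeadingCoeff f 3 + nextToLeadingCoeff f 1 * nextToLeadingCoeff f 2
      + nextToLeadingCoeff f 1 ^ 3⟩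

/-! ### Coefficient triples of monic polynomials, degree by degree. -/

section

variable {F : Type*} [Field F]

theorem coeffTriple_mul [CharP F 2] {f g : F[X]} (hf : f.Monic) (hg : g.Monic) :
    coeffTriple (f * g) = coeffTriple f + coeffTriple g := by
  have h : (2 : F) = 0 := CharTwo.two_eq_zero
  have hf0 : f.reverse.coeff 0 = 1 := by rw [coeff_zero_reverse]; exact hf
  have hg0 : g.reverse.coeff 0 = 1 := by rw [coeff_zero_reverse]; exact hg
  simp only [coeffTriple, CoeffTriple.add_def, nextToLeadingCoeff_eq_coeff_reverse,
    reverse_mul_of_domain, coeff_mul, Finset.Nat.sum_antidiagonal_eq_sum_range_succ_mk,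
    Finset.sum_range_succ, Finset.sum_range_zero, hf0, hg0, CoeffTriple.mk.injEq]
  norm_num [hf0, hg0, -coeff_one_reverse]
  generalize f.reverse.coeff 1 = a
  generalize f.reverse.coeff 2 = b
  generalize f.reverse.coeff 3 = c
  generalize g.reverse.coeff 1 = a'
  generalize g.reverse.coeff 2 = b'
  generalize g.reverse.coeff 3 = c'
  refine ⟨?_, ?_, ?_⟩
  · ring
  · ring
  · linear_combination (a * b' + a' * b + 2 * a ^ 2 * a' + 2 * a * a' ^ 2) * h

theorem coeffTriple_one : coeffTriple (1 : F[X]) = 0 := by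
  simp [coeffTriple, nextToLeadingCoeff, CoeffTriple.zero_def]

theorem coeffTriple_X_mul_add_C_of_three_le {f : F[X]} (hf : 3 ≤ f.natDegree) (a : F) :
    coeffTriple (X * f + C a) = coeffTriple f := by
  have h0 : f ≠ 0 := by rintro rfl; simp at hf
  simp only [coeffTriple, nextToLeadingCoeff_X_mul_add_C h0]
  rw [if_pos (by omega), if_pos (by omega), if_pos (by omega)]

theorem coeffTriple_linear (a : F) : coeffTriple (X * (1 : F[X]) + C a) = ⟨a, 0, a ^ 3⟩ := by
  simp only [coeffTriple, nextToLeadingCoeff_X_mul_add_C one_ne_zero, natDegree_one]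
  norm_num

theorem coeffTriple_quadratic (a b : F) :
    coeffTriple (X * (X * (1 : F[X]) + C a) + C b) = ⟨a, b, a * b + a ^ 3⟩ := by
  obtain ⟨h1, h1'⟩ := (monic_one (R := F)).X_mul_add_C a
  simp only [coeffTriple, nextToLeadingCoeff_X_mul_add_C h1.ne_zero, h1',
    nextToLeadingCoeff_X_mul_add_C one_ne_zero, natDegree_one]
  norm_num

theorem coeffTriple_cubic (a b c : F) :
    coeffTriple (X * (X * (X * (1 : F[X]) + C a) + C b) + C c)
      = ⟨a, b, c + (a * b + a ^ 3)⟩ := by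
  obtain ⟨h1, h1'⟩ := (monic_one (R := F)).X_mul_add_C a
  obtain ⟨h2, h2'⟩ := h1.X_mul_add_C b
  simp only [coeffTriple, nextToLeadingCoeff_X_mul_add_C h2.ne_zero, h2',
    nextToLeadingCoeff_X_mul_add_C h1.ne_zero, h1',
    nextToLeadingCoeff_X_mul_add_C one_ne_zero, natDegree_one]
  norm_num [add_assoc]

variable [Fintype F]

theorem sum_coeffTriple_zero {M : Type*} [AddCommMonoid M] (φ : CoeffTriple F → M) :
    ∑ f ∈ monicsOfDegree F 0, φ (coeffTriple f) = φ 0 := by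
  rw [monicsOfDegree_zero, Finset.sum_singleton, coeffTriple_one]

theorem sum_coeffTriple_one {M : Type*} [AddCommMonoid M] (φ : CoeffTriple F → M) :
    ∑ f ∈ monicsOfDegree F 1, φ (coeffTriple f) = ∑ a, φ ⟨a, 0, a ^ 3⟩ := by
  simp only [sum_monicsOfDegree_succ, monicsOfDegree_zero, Finset.sum_singleton,
    coeffTriple_linear]

theorem sum_coeffTriple_two {M : Type*} [AddCommMonoid M] (φ : CoeffTriple F → M) :
    ∑ f ∈ monicsOfDegree F 2, φ (coeffTriple f) = ∑ a, ∑ b, φ ⟨a, b, a * b + a ^ 3⟩ := by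
  simp only [sum_monicsOfDegree_succ, monicsOfDegree_zero, Finset.sum_singleton,
    coeffTriple_quadratic]

/-- In degree 3 every triple occurs exactly once, and each further coefficient is free. This is what
makes the L-functions of nontrivial characters polynomials of degree at most 2. -/
theorem sum_coeffTriple_add_three {M : Type*} [AddCommMonoid M] (φ : CoeffTriple F → M) (n : ℕ) :
    ∑ f ∈ monicsOfDegree F (n + 3), φ (coeffTriple f) = Fintype.card F ^ n • ∑ x, φ x := by
  induction n with
  | zero =>
    simp only [sum_monicsOfDegree_succ, monicsOfDegree_zero, Finset.sum_singleton,
      coeffTriple_cubic, CoeffTriple.sum_eq, pow_zero, one_smul]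
    refine Finset.sum_congr rfl fun a _ => Finset.sum_congr rfl fun b _ => ?_
    exact Equiv.sum_comp (Equiv.addRight (a * b + a ^ 3)) fun c => φ ⟨a, b, c⟩
  | succ n ih =>
    rw [show n + 1 + 3 = (n + 3) + 1 by ring, sum_monicsOfDegree_succ, pow_succ', mul_smul, ← ih,
      Finset.smul_sum]
    refine Finset.sum_congr rfl fun f hf => ?_
    have hd := (mem_monicsOfDegree.1 hf).2
    simp [coeffTriple_X_mul_add_C_of_three_le (f := f) (by omega)]

end

/-! ### Negated power sums of the inverse roots, at index 24. -/

section Recurrence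

theorem recurrence_value_of_sq_eq {v : ℕ → ℂ} {A B : ℂ} (h1 : v 1 = A)
    (h2 : v 2 = 2 * B - A * v 1) (h : ∀ n, v (n + 3) = -(A * v (n + 2)) - B * v (n + 1))
    {m : ℕ} (hm : m ≤ 4) (hA : A ^ 2 = m * B) : v 24 = -2 * B ^ 12 := by
  have h2' : v 2 = (2 - m) * B := by rw [h2, h1]; linear_combination -hA
  have h4 : v 4 = ((m - 2) * v 2 + 2 * B) * B := by
    rw [h 1, h 0, h1]
    simp only [zero_add]
    linear_combination (v 2 + B) * hA + B * h2'
  -- Moving two indices at a time, `A` enters only through `A ^ 2 = m B`, so the even-indexed terms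
  -- depend on `m` and `B` alone.
  have step : ∀ n, v (n + 5) = B * ((m - 2) * v (n + 3) - B * v (n + 1)) := by
    intro n
    have e1 : v (n + 5) = -(A * v (n + 4)) - B * v (n + 3) := h (n + 2)
    have e2 : v (n + 4) = -(A * v (n + 3)) - B * v (n + 2) := h (n + 1)
    linear_combination e1 - A * e2 + v (n + 3) * hA + B * h n
  rw [step 19, step 17, step 15, step 13, step 11, step 9, step 7, step 5, step 3, step 1]
  simp only [Nat.reduceAdd]
  rw [h4, h2']
  interval_cases m <;> push_cast <;> ring

theorem recurrence_value_of_eq_zero {v : ℕ → ℂ} {A : ℂ} (h1 : v 1 = A)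
    (h2 : v 2 = -(A * v 1)) (h : ∀ n, v (n + 3) = -(A * v (n + 2))) : v 24 = -A ^ 24 := by
  have key : ∀ n, v (n + 1) = (-1) ^ n * A ^ (n + 1) := by
    intro n
    induction n with
    | zero => simp [h1]
    | succ n ih =>
      cases n with
      | zero => rw [h2, h1]; ring
      | succ n => rw [h n, ih]; ring
  rw [key 23]
  ring

end Recurrence

/-! ### Characters of the triple group and their quadratic exponential sums. -/

section Characters

variable {F : Type*} [Field F]

/-- The value of `χ` at the class of the linear polynomial `T + a`. -/
noncomputable def linearValue (χ : AddChar (CoeffTriple F) ℂ) (a : F) : ℂ := χ ⟨a, 0, a ^ 3⟩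

variable {χ : AddChar (CoeffTriple F) ℂ} {ψ : AddChar F ℂ} {β γ κ : F}

/-- In characteristic two the cubes of `a` cancel, leaving an exponent in `a` built from `a ^ 2` and
`a`, which is additive. -/
theorem linearValue_mul_linearValue_add [CharP F 2]
    (hχ : ∀ a b c, χ ⟨a, b, c⟩ = χ ⟨a, 0, 0⟩ * ψ (β * b + γ * c)) (a s : F) :
    linearValue χ a * linearValue χ (a + s)
      = linearValue χ s * ψ ((β + γ * s) * a ^ 2 + s * (β + γ * s) * a) := by
  have h2 : (2 : F) = 0 := CharTwo.two_eq_zero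
  unfold linearValue
  rw [← AddChar.map_add_eq_mul, CoeffTriple.add_def]
  simp only
  rw [show a + (a + s) = s by linear_combination a * h2, hχ, hχ s 0 (s ^ 3), mul_assoc,
    ← AddChar.map_add_eq_mul]
  congr 2
  linear_combination (γ * (a ^ 3 + a ^ 2 * s + a * s ^ 2)) * h2

theorem linearValue_pow_four [CharP F 2] (s : F) : linearValue χ s ^ 4 = 1 := by
  rw [linearValue, ← AddChar.map_nsmul_eq_pow, CoeffTriple.four_nsmul_eq_zero,
    AddChar.map_zero_eq_one]

theorem linearValue_ne_zero [CharP F 2] (s : F) : linearValue χ s ≠ 0 := by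
  intro h
  have := linearValue_pow_four (χ := χ) s
  simp [h] at this

variable [Fintype F]

theorem exists_mulShift_eq {ψ : AddChar F ℂ} (hψ : ψ.IsPrimitive) (φ : AddChar F ℂ) :
    ∃ β, ∀ x, φ x = ψ (β * x) := by
  have hbij : Function.Bijective ψ.mulShift :=
    (Fintype.bijective_iff_injective_and_card _).2
      ⟨AddChar.to_mulShift_inj_of_isPrimitive hψ, AddChar.card_eq.symm⟩
  obtain ⟨β, rfl⟩ := hbij.2 φ
  exact ⟨β, fun x => AddChar.mulShift_apply⟩

theorem exists_char_two_parameters [CharP F 2] (χ : AddChar (CoeffTriple F) ℂ) :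
    ∃ (ψ : AddChar F ℂ) (β γ κ : F), ψ.IsPrimitive ∧ (∀ x, ψ (x ^ 2) = ψ (κ * x)) ∧
      ∀ a b c, χ ⟨a, b, c⟩ = χ ⟨a, 0, 0⟩ * ψ (β * b + γ * c) := by
  have h2 : (2 : F) = 0 := CharTwo.two_eq_zero
  obtain ⟨ψ, hψ⟩ : ∃ ψ : AddChar F ℂ, ψ.IsPrimitive := by
    obtain ⟨ψ, hψ⟩ := AddChar.exists_apply_ne_zero.2 (one_ne_zero (α := F))
    exact ⟨ψ, AddChar.IsPrimitive.of_ne_one (AddChar.ne_one_iff.2 ⟨1, hψ⟩)⟩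
  -- Squaring is additive in characteristic two, so `x ↦ ψ (x ^ 2)` is again a character of `F`.
  obtain ⟨κ, hκ⟩ := exists_mulShift_eq hψ
    { toFun := fun x => ψ (x ^ 2)
      map_zero_eq_one' := by simp
      map_add_eq_mul' := fun x y => by
        rw [← AddChar.map_add_eq_mul]; congr 1; linear_combination x * y * h2 }
  obtain ⟨β, hβ⟩ := exists_mulShift_eq hψ
    { toFun := fun x => χ ⟨0, x, 0⟩
      map_zero_eq_one' := χ.map_zero_eq_one
      map_add_eq_mul' := fun x y => by
        rw [← AddChar.map_add_eq_mul]; simp [CoeffTriple.add_def] }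
  obtain ⟨γ, hγ⟩ := exists_mulShift_eq hψ
    { toFun := fun x => χ ⟨0, 0, x⟩
      map_zero_eq_one' := χ.map_zero_eq_one
      map_add_eq_mul' := fun x y => by
        rw [← AddChar.map_add_eq_mul]; simp [CoeffTriple.add_def] }
  refine ⟨ψ, β, γ, κ, hψ, hκ, fun a b c => ?_⟩
  rw [AddChar.map_add_eq_mul, ← hβ, ← hγ]
  simp only [AddChar.coe_mk]
  rw [← AddChar.map_add_eq_mul, ← AddChar.map_add_eq_mul]
  simp [CoeffTriple.add_def]

open Classical in
theorem sum_linearValue_sq [CharP F 2] (hψ : ψ.IsPrimitive) (hκ : ∀ x, ψ (x ^ 2) = ψ (κ * x))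
    (hχ : ∀ a b c, χ ⟨a, b, c⟩ = χ ⟨a, 0, 0⟩ * ψ (β * b + γ * c)) :
    (∑ a, linearValue χ a) ^ 2 = Fintype.card F *
      ∑ s with κ ^ 2 * (β + γ * s) = s ^ 2 * (β + γ * s) ^ 2, linearValue χ s := by
  have h2 : (2 : F) = 0 := CharTwo.two_eq_zero
  have h1 : (∑ a, linearValue χ a) ^ 2
      = ∑ s, ∑ a, linearValue χ a * linearValue χ (a + s) := by
    rw [sq, Finset.sum_mul, Finset.sum_comm]
    refine Finset.sum_congr rfl fun a _ => ?_
    rw [Finset.mul_sum]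
    exact (Equiv.sum_comp (Equiv.addLeft a) fun b => linearValue χ a * linearValue χ b).symm
  rw [h1, Finset.mul_sum, Finset.sum_filter]
  refine Finset.sum_congr rfl fun s _ => ?_
  -- With this square root, `v ^ 2 * a ^ 2 = (v * a) ^ 2` and `κ` makes the exponent linear in `a`;
  -- orthogonality then applies.
  obtain ⟨v, hv⟩ : ∃ v, v ^ 2 = β + γ * s := surjective_frobenius F 2 (β + γ * s)
  simp only [linearValue_mul_linearValue_add hχ, ← hv]
  have h3 : ∀ a, ψ (v ^ 2 * a ^ 2 + s * v ^ 2 * a) = ψ (a * (κ * v + s * v ^ 2)) := by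
    intro a
    rw [AddChar.map_add_eq_mul, ← mul_pow, hκ, ← AddChar.map_add_eq_mul]
    congr 1
    ring
  rw [← Finset.mul_sum, Finset.sum_congr rfl fun a _ => h3 a, AddChar.sum_mulShift _ hψ]
  -- Squaring removes `v` itself, so the condition becomes polynomial in `s`.
  have h4 : κ * v + s * v ^ 2 = 0 ↔ κ ^ 2 * v ^ 2 = s ^ 2 * (v ^ 2) ^ 2 := by
    rw [← sub_eq_zero (b := s ^ 2 * (v ^ 2) ^ 2), ← pow_eq_zero_iff (two_ne_zero)]
    have : (κ * v + s * v ^ 2) ^ 2 = κ ^ 2 * v ^ 2 - s ^ 2 * (v ^ 2) ^ 2 := by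
      linear_combination (κ * v ^ 3 * s + s ^ 2 * v ^ 4) * h2
    rw [this]
  simp only [h4]
  split_ifs <;> simp [mul_comm]

open Classical in
theorem sum_quadratic [CharP F 2] (hψ : ψ.IsPrimitive)
    (hχ : ∀ a b c, χ ⟨a, b, c⟩ = χ ⟨a, 0, 0⟩ * ψ (β * b + γ * c)) :
    ∑ a, ∑ b, χ ⟨a, b, a * b + a ^ 3⟩
      = ∑ a, if β + γ * a = 0 then Fintype.card F * linearValue χ a else 0 := by
  refine Finset.sum_congr rfl fun a _ => ?_
  have h : ∀ b, χ ⟨a, b, a * b + a ^ 3⟩ = linearValue χ a * ψ (b * (β + γ * a)) := by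
    intro b
    rw [linearValue, hχ, hχ a 0 (a ^ 3), mul_assoc, ← AddChar.map_add_eq_mul]
    congr 2
    ring
  rw [Finset.sum_congr rfl fun b _ => h b, ← Finset.mul_sum, AddChar.sum_mulShift _ hψ]
  split_ifs <;> simp [mul_comm]

end Characters

theorem re_eq_intCast_of_pow_four_eq_one {z : ℂ} (hz : z ^ 4 = 1) :
    ∃ m : ℤ, m ≤ 1 ∧ z.re = m := by
  have h : (z - 1) * (z + 1) * (z - Complex.I) * (z + Complex.I) = 0 := by
    linear_combination hz + (1 - z ^ 2) * Complex.I_sq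
  rcases mul_eq_zero.1 h with h | h
  · rcases mul_eq_zero.1 h with h | h
    · rcases mul_eq_zero.1 h with h | h
      · exact ⟨1, le_rfl, by simp [sub_eq_zero.1 h]⟩
      · exact ⟨-1, by norm_num, by simp [eq_neg_of_add_eq_zero_left h]⟩
    · exact ⟨0, by norm_num, by simp [sub_eq_zero.1 h]⟩
  · exact ⟨0, by norm_num, by simp [eq_neg_of_add_eq_zero_left h]⟩

/-! ### Relations between `A` and `B`, according to the level of the character. -/

section Levels

variable {F : Type*} [Field F] [Fintype F] {β γ κ : F}

open Classical in
theorem card_support_le_four (hγ : γ ≠ 0) :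
    (Finset.univ.filter fun s : F =>
      κ ^ 2 * (β + γ * s) = s ^ 2 * (β + γ * s) ^ 2).card ≤ 4 := by
  set p : F[X] := X ^ 2 * (C β + C γ * X) ^ 2 - C (κ ^ 2) * (C β + C γ * X) with hp
  have hc : p = C (γ ^ 2) * X ^ 4 + C (2 * β * γ) * X ^ 3 + C (β ^ 2) * X ^ 2
      + C (-(κ ^ 2 * γ)) * X + C (-(κ ^ 2 * β)) := by
    rw [hp]; simp only [C_neg, C_mul, C_pow, C_ofNat]; ring
  have hd : p.natDegree = 4 := by
    rw [hc]; compute_degree!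
  have hp0 : p ≠ 0 := by rintro h; rw [h] at hd; simp at hd
  rw [← hd]
  refine (Finset.card_le_card fun s hs => ?_).trans
    ((Multiset.toFinset_card_le p.roots).trans (card_roots' p))
  rw [Multiset.mem_toFinset, mem_roots hp0, IsRoot.def, hp]
  have := (Finset.mem_filter.1 hs).2
  simp only [eval_sub, eval_mul, eval_pow, eval_X, eval_add, eval_C]
  rw [this, sub_self]

variable [CharP F 2]
  {χ : AddChar (CoeffTriple F) ℂ} {ψ : AddChar F ℂ}

/-- At `s₀` the exponent in `a` vanishes, so `a ↦ a + s₀` sends each unimodular value to its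
conjugate times the value at `s₀`. This fixes the argument of the sum up to sign. -/
theorem linearValue_conj_mul
    (hχ : ∀ a b c, χ ⟨a, b, c⟩ = χ ⟨a, 0, 0⟩ * ψ (β * b + γ * c)) {s₀ : F}
    (hs : β + γ * s₀ = 0) :
    (starRingEnd ℂ) (∑ a, linearValue χ a) * linearValue χ s₀ = ∑ a, linearValue χ a := by
  rw [map_sum, Finset.sum_mul, ← Equiv.sum_comp (Equiv.addRight s₀) (linearValue χ)]
  refine Finset.sum_congr rfl fun a _ => ?_
  have h1 := linearValue_mul_linearValue_add hχ a s₀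
  rw [hs] at h1
  have h2 : ‖linearValue χ a‖ = 1 := AddChar.norm_apply χ _
  have h3 : (starRingEnd ℂ) (linearValue χ a) * linearValue χ a = 1 := by
    rw [mul_comm, Complex.mul_conj, Complex.normSq_eq_norm_sq, h2]; norm_num
  have h4 : linearValue χ a * linearValue χ (a + s₀) = linearValue χ s₀ := by
    simpa using h1
  rw [← h4, ← mul_assoc, h3, one_mul]
  rfl

theorem level_three_relation (hψ : ψ.IsPrimitive) (hκ : ∀ x, ψ (x ^ 2) = ψ (κ * x))
    (hχ : ∀ a b c, χ ⟨a, b, c⟩ = χ ⟨a, 0, 0⟩ * ψ (β * b + γ * c)) (hγ : γ ≠ 0) :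
    ∃ (m : ℕ) (s₀ : F), m ≤ 4 ∧
      ∑ a, ∑ b, χ ⟨a, b, a * b + a ^ 3⟩ = Fintype.card F * linearValue χ s₀ ∧
      (∑ a, linearValue χ a) ^ 2 = m * (Fintype.card F * linearValue χ s₀) := by
  classical
  obtain ⟨s₀, hs⟩ : ∃ s₀ : F, β + γ * s₀ = 0 := ⟨-(β / γ), by field_simp; ring⟩
  have huniq : ∀ a, β + γ * a = 0 ↔ a = s₀ := by
    refine fun a => ⟨fun h => mul_left_cancel₀ hγ ?_, by rintro rfl; exact hs⟩
    linear_combination h - hs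
  have hε := linearValue_ne_zero (χ := χ) s₀
  have hq : (0 : ℝ) < Fintype.card F := by exact_mod_cast Fintype.card_pos
  have hqC : (Fintype.card F : ℂ) ≠ 0 := by exact_mod_cast hq.ne'
  set S := Finset.univ.filter fun s : F =>
      κ ^ 2 * (β + γ * s) = s ^ 2 * (β + γ * s) ^ 2 with hS
  have hmem : s₀ ∈ S := by simp [hS, hs]
  have hcard : (S.erase s₀).card ≤ 3 := by
    rw [Finset.card_erase_of_mem hmem]
    have : S.card ≤ 4 := by convert card_support_le_four (β := β) (κ := κ) hγ
    omega
  set A := ∑ a, linearValue χ a with hA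
  have hA2 : A ^ 2 = Fintype.card F * ∑ s ∈ S, linearValue χ s := sum_linearValue_sq hψ hκ hχ
  set T := ∑ s ∈ S.erase s₀, linearValue χ s / linearValue χ s₀ with hT
  have hA3 : A ^ 2 = (1 + T) * (Fintype.card F * linearValue χ s₀) := by
    rw [hA2, ← Finset.add_sum_erase S _ hmem, hT, add_mul, Finset.sum_mul, mul_add,
      Finset.mul_sum, one_mul]
    congr 1
    refine Finset.sum_congr rfl fun s _ => ?_
    field_simp
  have hconj := linearValue_conj_mul hχ hs
  rw [← hA] at hconj
  -- By `hconj`, `A ^ 2` is `|A| ^ 2` times the value at `s₀`. So `1 + T` is real and nonnegative;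
  -- as a sum of at most four fourth roots of unity, it is then an integer between 0 and 4.
  have hT2 : 1 + T = ((Complex.normSq A / Fintype.card F : ℝ) : ℂ) := by
    push_cast
    rw [eq_div_iff hqC]
    apply mul_right_cancel₀ hε
    rw [← Complex.mul_conj]
    linear_combination -hA3 - A * hconj
  have hint : ∀ s, ∃ m : ℤ, m ≤ 1 ∧ (linearValue χ s / linearValue χ s₀).re = m := fun s =>
    re_eq_intCast_of_pow_four_eq_one (by
      rw [div_pow, linearValue_pow_four, linearValue_pow_four, div_one])
  choose g hg1 hg2 using hint
  have hre : (1 + T).re = ((1 + ∑ s ∈ S.erase s₀, g s : ℤ) : ℝ) := by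
    push_cast
    rw [Complex.add_re, hT, Complex.re_sum, Complex.one_re]
    congr 1
    exact Finset.sum_congr rfl fun s _ => hg2 s
  have hnonneg : 0 ≤ 1 + ∑ s ∈ S.erase s₀, g s := by
    have : (0 : ℝ) ≤ (1 + T).re := by
      rw [hT2, Complex.ofReal_re]; exact div_nonneg (Complex.normSq_nonneg A) hq.le
    rw [hre] at this
    exact_mod_cast this
  have hle : 1 + ∑ s ∈ S.erase s₀, g s ≤ 4 := by
    have : ∑ s ∈ S.erase s₀, g s ≤ (S.erase s₀).card • (1 : ℤ) :=
      Finset.sum_le_card_nsmul _ _ _ fun s _ => hg1 s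
    rw [nsmul_eq_mul, mul_one] at this
    omega
  obtain ⟨m, hm⟩ := Int.eq_ofNat_of_zero_le hnonneg
  refine ⟨m, s₀, by omega, ?_, ?_⟩
  · rw [sum_quadratic hψ hχ]
    simp [huniq]
  · rw [hA3]
    congr 1
    have h5 : (1 + T).re = (m : ℝ) := by rw [hre, hm]; simp
    rw [hT2, Complex.ofReal_re] at h5
    rw [hT2, h5]
    simp

theorem level_two_relation (hψ : ψ.IsPrimitive) (hκ : ∀ x, ψ (x ^ 2) = ψ (κ * x))
    (hχ : ∀ a b c, χ ⟨a, b, c⟩ = χ ⟨a, 0, 0⟩ * ψ (β * b + 0 * c)) (hβ : β ≠ 0) :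
    ∑ a, ∑ b, χ ⟨a, b, a * b + a ^ 3⟩ = 0 ∧
      ∃ s, (∑ a, linearValue χ a) ^ 2 = Fintype.card F * linearValue χ s := by
  classical
  refine ⟨by simp [sum_quadratic hψ hχ, hβ], ?_⟩
  obtain ⟨v, hv⟩ : ∃ v, v ^ 2 = β := surjective_frobenius F 2 β
  -- With `γ = 0` the support condition reduces to `s ^ 2 = κ ^ 2 / β`, which has one solution in
  -- characteristic two.
  refine ⟨κ / v, ?_⟩
  rw [sum_linearValue_sq hψ hκ hχ, Finset.sum_filter]
  have h : ∀ s, κ ^ 2 * (β + 0 * s) = s ^ 2 * (β + 0 * s) ^ 2 ↔ s = κ / v := by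
    intro s
    rw [← frobenius_inj F 2 |>.eq_iff (a := s), frobenius_def, frobenius_def, div_pow, hv,
      eq_div_iff hβ, zero_mul, add_zero, sq β, ← mul_assoc, mul_left_inj' hβ, eq_comm]
  simp only [h, Finset.sum_ite_eq', Finset.mem_univ, if_true]

theorem level_one_relation (hψ : ψ.IsPrimitive)
    (hχ : ∀ a b c, χ ⟨a, b, c⟩ = χ ⟨a, 0, 0⟩ * ψ (0 * b + 0 * c)) (hne : χ ≠ 0) :
    ∑ a, ∑ b, χ ⟨a, b, a * b + a ^ 3⟩ = 0 ∧ ∑ a, linearValue χ a = 0 := by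
  classical
  have h0 : ∑ a, χ ⟨a, 0, 0⟩ = 0 := by
    have h := (AddChar.sum_eq_zero_iff_ne_zero (ψ := χ)).2 hne
    rw [CoeffTriple.sum_eq] at h
    have e : ∀ a b c, χ ⟨a, b, c⟩ = χ ⟨a, 0, 0⟩ := fun a b c => by rw [hχ]; simp
    rw [Finset.sum_congr rfl fun a _ => Finset.sum_congr rfl fun b _ =>
      Finset.sum_congr rfl fun c _ => e a b c] at h
    simpa [← Finset.mul_sum] using h
  have h1 : ∑ a, linearValue χ a = 0 := by
    rw [← h0]
    refine Finset.sum_congr rfl fun a _ => ?_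
    rw [linearValue, hχ]; simp
  refine ⟨?_, h1⟩
  rw [sum_quadratic hψ hχ]
  simp [← Finset.mul_sum, h1]

end Levels

/-! ### Twisted von Mangoldt sums. -/

section Fourier

variable {F : Type*} [Field F]

theorem linearValue_pow_twelve [CharP F 2] (χ : AddChar (CoeffTriple F) ℂ) (s : F) :
    linearValue χ s ^ 12 = 1 := by
  rw [show 12 = 4 * 3 by norm_num, pow_mul, linearValue_pow_four, one_pow]

variable [Fintype F]

/-- The sum of `Λ χ` over the monic polynomials of degree `n`. -/
noncomputable def twistedPsi (χ : AddChar (CoeffTriple F) ℂ) (n : ℕ) : ℂ :=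
  ∑ f ∈ monicsOfDegree F n, polyVonMangoldt f * χ (coeffTriple f)

variable [CharP F 2]

theorem twistedPsi_convolution (χ : AddChar (CoeffTriple F) ℂ) (n : ℕ) :
    (n : ℂ) * ∑ f ∈ monicsOfDegree F n, χ (coeffTriple f)
      = ∑ k ∈ Finset.range (n + 1),
          twistedPsi χ k * ∑ e ∈ monicsOfDegree F (n - k), χ (coeffTriple e) :=
  natCast_mul_sum_monicsOfDegree (fun f => χ (coeffTriple f))
    (fun f g hf hg => by rw [coeffTriple_mul hf hg, AddChar.map_add_eq_mul]) n

theorem twistedPsi_zero_right (χ : AddChar (CoeffTriple F) ℂ) : twistedPsi χ 0 = 0 := by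
  have h := twistedPsi_convolution χ 0
  simpa [sum_coeffTriple_zero] using h.symm

theorem twistedPsi_zero_left {n : ℕ} (hn : n ≠ 0) :
    twistedPsi (0 : AddChar (CoeffTriple F) ℂ) n = (Fintype.card F : ℂ) ^ n := by
  have hc : ∀ n, ∑ f ∈ monicsOfDegree F n, (0 : AddChar (CoeffTriple F) ℂ) (coeffTriple f)
      = (Fintype.card F : ℂ) ^ n := by
    intro n
    induction n with
    | zero => rw [sum_coeffTriple_zero]; simp
    | succ n ih =>
      simp only [AddChar.zero_apply] at ih ⊢
      rw [sum_monicsOfDegree_succ, pow_succ, ← ih, Finset.sum_mul]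
      simp
  obtain ⟨n, rfl⟩ := Nat.exists_eq_succ_of_ne_zero hn
  have h1 := twistedPsi_convolution (0 : AddChar (CoeffTriple F) ℂ) n
  have h2 := twistedPsi_convolution (0 : AddChar (CoeffTriple F) ℂ) (n + 1)
  simp only [hc] at h1 h2
  -- Apart from the term `k = n + 1`, the convolution in degree `n + 1` is `q` times the one in
  -- degree `n`.
  rw [Finset.sum_range_succ, Finset.sum_congr rfl (g := fun k =>
    (Fintype.card F : ℂ) * (twistedPsi (0 : AddChar (CoeffTriple F) ℂ) k
      * (Fintype.card F : ℂ) ^ (n - k))), ← Finset.mul_sum, ← h1] at h2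
  · simp only [Nat.sub_self, pow_zero, mul_one] at h2
    push_cast at h2
    rw [Nat.succ_eq_add_one]
    linear_combination -h2
  · intro k hk
    have := Finset.mem_range.1 hk
    rw [show n + 1 - k = (n - k) + 1 by omega, pow_succ]
    ring

theorem twistedPsi_recurrence {χ : AddChar (CoeffTriple F) ℂ} (hχ : χ ≠ 0) :
    twistedPsi χ 1 = ∑ a, linearValue χ a ∧
    twistedPsi χ 2 = 2 * ∑ a, ∑ b, χ ⟨a, b, a * b + a ^ 3⟩
      - (∑ a, linearValue χ a) * twistedPsi χ 1 ∧
    ∀ n, twistedPsi χ (n + 3) = -((∑ a, linearValue χ a) * twistedPsi χ (n + 2))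
      - (∑ a, ∑ b, χ ⟨a, b, a * b + a ^ 3⟩) * twistedPsi χ (n + 1) := by
  have h0 := twistedPsi_zero_right χ
  have c0 : ∑ f ∈ monicsOfDegree F 0, χ (coeffTriple f) = 1 := by
    rw [sum_coeffTriple_zero, AddChar.map_zero_eq_one]
  have c1 : ∑ f ∈ monicsOfDegree F 1, χ (coeffTriple f) = ∑ a, linearValue χ a :=
    sum_coeffTriple_one χ
  have c2 : ∑ f ∈ monicsOfDegree F 2, χ (coeffTriple f)
      = ∑ a, ∑ b, χ ⟨a, b, a * b + a ^ 3⟩ := sum_coeffTriple_two χ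
  have c3 : ∀ n, ∑ f ∈ monicsOfDegree F (n + 3), χ (coeffTriple f) = 0 := fun n => by
    rw [sum_coeffTriple_add_three, AddChar.sum_eq_zero_iff_ne_zero.2 hχ, smul_zero]
  refine ⟨?_, ?_, fun n => ?_⟩
  · have h := twistedPsi_convolution χ 1
    simp only [Finset.sum_range_succ, Finset.sum_range_zero, h0, Nat.sub_self, c0, c1] at h
    push_cast at h
    linear_combination -h
  · have h := twistedPsi_convolution χ 2
    simp only [Finset.sum_range_succ, Finset.sum_range_zero, h0, Nat.sub_self, c0, c2,
      Nat.reduceSub, c1] at h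
    push_cast at h
    linear_combination -h
  · have h := twistedPsi_convolution χ (n + 3)
    rw [c3, mul_zero, Finset.sum_range_succ, Finset.sum_range_succ, Finset.sum_range_succ,
      Finset.sum_eq_zero, show n + 3 - (n + 3) = 0 by omega, show n + 3 - (n + 2) = 1 by omega,
      show n + 3 - (n + 1) = 2 by omega, c0, c1, c2] at h
    · linear_combination -h
    · intro k hk
      have := Finset.mem_range.1 hk
      rw [show n + 3 - k = (n - k) + 3 by omega, c3, mul_zero]

/-- The sums over subgroups on the right detect the level of `χ`, so one formula covers the four
values `q ^ 24`, `0`, `-q ^ 12`, `-2 q ^ 12`, and it is already the Fourier transform of the claimed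
answer. -/
theorem twistedPsi_twentyFour (χ : AddChar (CoeffTriple F) ℂ) :
    twistedPsi χ 24 = (Fintype.card F : ℂ) ^ 21 * ∑ x, χ x
      - 2 * (Fintype.card F : ℂ) ^ 12 + (Fintype.card F : ℂ) ^ 11 * ∑ c, χ ⟨0, 0, c⟩
      + (Fintype.card F : ℂ) ^ 10 * ∑ b, ∑ c, χ ⟨0, b, c⟩ := by
  classical
  have hq : (Fintype.card F : ℂ) ≠ 0 := by exact_mod_cast Fintype.card_ne_zero
  by_cases hne : χ = 0
  · subst hne
    rw [twistedPsi_zero_left (by norm_num)]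
    simp only [AddChar.zero_apply, Finset.sum_const, Finset.card_univ, nsmul_eq_mul, mul_one,
      CoeffTriple.card_eq, Nat.cast_pow]
    ring
  obtain ⟨h1, h2, h3⟩ := twistedPsi_recurrence hne
  obtain ⟨ψ, β, γ, κ, hψ, hκ, hχ⟩ := exists_char_two_parameters χ
  have e0 : ∑ x, χ x = 0 := AddChar.sum_eq_zero_iff_ne_zero.2 hne
  have e3 : ∑ c, χ ⟨0, 0, c⟩ = if γ = 0 then (Fintype.card F : ℂ) else 0 := by
    have : ∀ c, χ ⟨0, 0, c⟩ = ψ (c * γ) := fun c => by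
      rw [hχ, ← CoeffTriple.zero_def, AddChar.map_zero_eq_one, one_mul]; congr 1; ring
    rw [Finset.sum_congr rfl fun c _ => this c, AddChar.sum_mulShift _ hψ]
    push_cast; rfl
  have e2 : ∑ b, ∑ c, χ ⟨0, b, c⟩
      = (if β = 0 then (Fintype.card F : ℂ) else 0) * if γ = 0 then (Fintype.card F : ℂ) else 0 := by
    have : ∀ b c, χ ⟨0, b, c⟩ = ψ (b * β) * χ ⟨0, 0, c⟩ := fun b c => by
      rw [hχ, hχ 0 0 c, ← CoeffTriple.zero_def, AddChar.map_zero_eq_one, one_mul, one_mul,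
        ← AddChar.map_add_eq_mul]
      congr 1; ring
    rw [Finset.sum_congr rfl fun b _ => Finset.sum_congr rfl fun c _ => this b c]
    simp_rw [← Finset.mul_sum, ← Finset.sum_mul, e3]
    rw [AddChar.sum_mulShift _ hψ]
    push_cast; rfl
  rw [e0, e2, e3]
  by_cases hγ : γ = 0
  · subst hγ
    by_cases hβ : β = 0
    · subst hβ
      obtain ⟨hB, hA⟩ := level_one_relation hψ hχ hne
      rw [hB, hA] at h2 h3
      rw [recurrence_value_of_eq_zero (h1.trans hA) (by rw [h2]; ring)
        (fun n => by rw [h3]; ring)]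
      simp
      ring
    · obtain ⟨hB, s, hA⟩ := level_two_relation hψ hκ hχ hβ
      rw [hB] at h2 h3
      rw [recurrence_value_of_eq_zero h1 (by rw [h2]; ring) (fun n => by rw [h3]; ring),
        show 24 = 2 * 12 by norm_num, pow_mul, hA, mul_pow, linearValue_pow_twelve]
      simp [hβ]
      ring
  · obtain ⟨m, s, hm, hB, hA⟩ := level_three_relation hψ hκ hχ hγ
    rw [← hB] at hA
    rw [recurrence_value_of_sq_eq h1 h2 h3 hm hA, hB, mul_pow, linearValue_pow_twelve]
    simp [hγ]

end Fourier

/-! ### Fourier inversion and the conclusion. -/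

theorem eq_of_sum_addChar_eq {G : Type*} [AddCommGroup G] [Fintype G] {φ φ' : G → ℂ}
    (h : ∀ χ : AddChar G ℂ, ∑ x, φ x * χ x = ∑ x, φ' x * χ x) : φ = φ' := by
  classical
  have key : ∀ (φ : G → ℂ) (y : G),
      ∑ χ : AddChar G ℂ, χ (-y) * ∑ x, φ x * χ x = Fintype.card G * φ y := by
    intro φ y
    simp_rw [Finset.mul_sum]
    rw [Finset.sum_comm]
    have : ∀ x, ∑ χ : AddChar G ℂ, χ (-y) * (φ x * χ x)
        = if x = y then Fintype.card G * φ x else 0 := by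
      intro x
      have h1 : ∀ χ : AddChar G ℂ, χ (-y) * (φ x * χ x) = φ x * χ (x - y) := fun χ => by
        rw [sub_eq_neg_add, AddChar.map_add_eq_mul]; ring
      rw [Finset.sum_congr rfl fun χ _ => h1 χ, ← Finset.mul_sum, AddChar.sum_apply_eq_ite]
      simp only [sub_eq_zero]
      split_ifs <;> ring
    rw [Finset.sum_congr rfl fun x _ => this x]
    simp
  funext y
  have hG : (Fintype.card G : ℂ) ≠ 0 := by exact_mod_cast Fintype.card_ne_zero
  apply mul_left_cancel₀ hG
  rw [← key, ← key]
  exact Finset.sum_congr rfl fun χ _ => by rw [h χ]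

theorem mainTheorem7 {F : Type*} [Field F] [Finite F] [DecidableEq F] (q r : ℕ) (hr : 1 ≤ r)
    (hq : q = 2 ^ r) (hF : Nat.card F = q) (t₁ t₂ t₃ : F) :
    polyPsi 24 ![t₁, t₂, t₃] =
      (q : ℂ) ^ 21 - (q : ℂ) ^ 10 *
        (2 * (q : ℂ) ^ 2 * (if t₁ = 0 ∧ t₂ = 0 ∧ t₃ = 0 then 1 else 0)
          - (q : ℂ) * (if t₁ = 0 ∧ t₂ = 0 then 1 else 0)
          - (if t₁ = 0 then 1 else 0)) := by
  classical
  let _ := Fintype.ofFinite F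
  have hcard : Fintype.card F = q := by rw [← hF, Nat.card_eq_fintype_card]
  have : Fact (Nat.Prime 2) := ⟨Nat.prime_two⟩
  have : CharP F 2 := charP_of_card_eq_prime_pow (hcard.trans hq)
  have h1 : (fun x : CoeffTriple F => ∑ f ∈ monicsOfDegree F 24,
      if coeffTriple f = x then polyVonMangoldt f else 0) = fun x : CoeffTriple F =>
      (q : ℂ) ^ 21 - (q : ℂ) ^ 10 *
        (2 * (q : ℂ) ^ 2 * (if x.fst = 0 ∧ x.snd = 0 ∧ x.trd = 0 then 1 else 0)
          - (q : ℂ) * (if x.fst = 0 ∧ x.snd = 0 then 1 else 0)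
          - (if x.fst = 0 then 1 else 0)) := by
    refine eq_of_sum_addChar_eq fun χ => ?_
    have l : ∑ x, (∑ f ∈ monicsOfDegree F 24,
        if coeffTriple f = x then polyVonMangoldt f else 0) * χ x = twistedPsi χ 24 := by
      simp_rw [Finset.sum_mul]
      rw [Finset.sum_comm]
      simp [twistedPsi]
    rw [l, twistedPsi_twentyFour, hcard]
    have s3 : ∑ x : CoeffTriple F,
        (if x.fst = 0 ∧ x.snd = 0 ∧ x.trd = 0 then (1 : ℂ) else 0) * χ x = 1 := by
      rw [CoeffTriple.sum_eq]
      have h : χ ⟨0, 0, 0⟩ = 1 := χ.map_zero_eq_one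
      simp [ite_and, h]
    have s2 : ∑ x : CoeffTriple F,
        (if x.fst = 0 ∧ x.snd = 0 then (1 : ℂ) else 0) * χ x = ∑ c, χ ⟨0, 0, c⟩ := by
      rw [CoeffTriple.sum_eq]
      simp [ite_and]
    have s1 : ∑ x : CoeffTriple F, (if x.fst = 0 then (1 : ℂ) else 0) * χ x
        = ∑ b, ∑ c, χ ⟨0, b, c⟩ := by
      rw [CoeffTriple.sum_eq]
      simp
    rw [← s2, ← s1]
    have e : ∀ x : CoeffTriple F, ((q : ℂ) ^ 21 - (q : ℂ) ^ 10 *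
        (2 * (q : ℂ) ^ 2 * (if x.fst = 0 ∧ x.snd = 0 ∧ x.trd = 0 then 1 else 0)
          - (q : ℂ) * (if x.fst = 0 ∧ x.snd = 0 then 1 else 0)
          - (if x.fst = 0 then 1 else 0))) * χ x
        = (q : ℂ) ^ 21 * χ x - 2 * (q : ℂ) ^ 12 *
            ((if x.fst = 0 ∧ x.snd = 0 ∧ x.trd = 0 then (1 : ℂ) else 0) * χ x)
          + (q : ℂ) ^ 11 * ((if x.fst = 0 ∧ x.snd = 0 then (1 : ℂ) else 0) * χ x)
          + (q : ℂ) ^ 10 * ((if x.fst = 0 then (1 : ℂ) else 0) * χ x) := fun x => by ring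
    rw [Finset.sum_congr rfl fun x _ => e x, Finset.sum_add_distrib, Finset.sum_add_distrib,
      Finset.sum_sub_distrib, ← Finset.mul_sum, ← Finset.mul_sum, ← Finset.mul_sum,
      ← Finset.mul_sum, s3, mul_one]
  -- The third coordinate is the one `coeffTriple` assigns to `t₁, t₂, t₃`; it equals `t₃` once `t₁
  -- = t₂ = 0`, so the indicators are unchanged.
  have h2 := congrFun h1 ⟨t₁, t₂, t₃ + t₁ * t₂ + t₁ ^ 3⟩
  simp only at h2
  have h3 : (t₁ = 0 ∧ t₂ = 0 ∧ t₃ + t₁ * t₂ + t₁ ^ 3 = 0) ↔ (t₁ = 0 ∧ t₂ = 0 ∧ t₃ = 0) := by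
    constructor
    · rintro ⟨rfl, rfl, h⟩; simpa using h
    · rintro ⟨rfl, rfl, rfl⟩; simp
  simp only [h3] at h2
  rw [← h2, polyPsi, finsum_mem_eq_finite_toFinset_sum _ (monicPrescribed_finite 24 _),
    ← Finset.sum_filter]
  refine Finset.sum_congr ?_ fun _ _ => rfl
  ext f
  rw [Set.Finite.mem_toFinset, Finset.mem_filter, mem_monicsOfDegree, and_assoc]
  refine and_congr_right fun _ => and_congr_right fun _ => ?_
  simp only [Fin.forall_fin_succ, coeffTriple, CoeffTriple.mk.injEq]
  norm_num
  rintro rfl rfl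
  simp only [add_left_inj]
  rfl
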